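/- Let $0\le k<n$ be integers. The $(2n+1)\times(2n+1)$ lattice is the closed plane curve consisting of $2n+1$ horizontal and $2n+1$ vertical segments: starting at the upper left corner it runs through all rows from top to bottom, alternately to the right and to the left, turns from the right end of the last row to the lower end of the last column, and then runs through all columns from right to left, alternately upwards and downwards, back to the starting point. A lattice knot is obtained from it by choosing one of the two crossing types at each of its $(2n+1)^2$ crossing points. For $0\le i,j\le n-k$, the block at position $(i,j)$ consists of the crossing points in $2k+1$ consecutive rows and $2k+1$ consecutive columns, with $2i$ rows above it and $2j$ columns to its left. Say that a choice of crossing types at all crossing points outside this block embeds the $(2k+1)\times(2k+1)$ lattice at position $(i,j)$ if, for every choice of the crossing types inside the block, the lattice knot so obtained can be transformed, by Reidemeister moves in which no crossing of the block takes part, into the $(2k+1)\times(2k+1)$ lattice knot with the crossing types of the block. (So all crossings outside the block are untied, and an arbitrary lattice knot of the smaller lattice is obtained.) Then the number of pairs consisting of a position $(i,j)$ and a choice of crossing types outside the block that embeds the $(2k+1)\times(2k+1)$ lattice at that position is greater than $$(n-k+1)^2\left[2^{2(n-k)(n+k+2)}+2^{(n-k)(n+3k+4)}\left(1-\delta_{n-k,1}-\delta_{n-k,0}\right)\right].$$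 -/

import Mathlib

/-- One passage of an oriented knot diagram through a crossing: the name of the crossing, whether
the passage is the upper one, and the sign (writhe) of the crossing. -/
structure Letter (α : Type*) where
  crossing : α
  above : Bool
  sign : ℤˣ

/-- Renaming of the crossing of a letter. -/
def Letter.relabel {α β : Type*} (f : α → β) (x : Letter α) : Letter β :=
  ⟨f x.crossing, x.above, x.sign⟩

/-- A signed Gauss code of an oriented knot diagram: the passages in the order in which the curve
meets them, from some base point. The list is read cyclically; the empty list is the round circle. -/
abbrev GaussCode (α : Type*) := List (Letter α)

namespace GaussCode

variable {α : Type*}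

/-- Every crossing that occurs is passed exactly twice, once above and once below, and both
passages carry the same sign. -/
def IsProper (w : GaussCode α) : Prop :=
  w.Nodup ∧ (∀ x ∈ w, (⟨x.crossing, !x.above, x.sign⟩ : Letter α) ∈ w) ∧
    ∀ x ∈ w, ∀ y ∈ w, x.crossing = y.crossing → x.sign = y.sign

/-- A directed edge of the diagram. The edge number `i` runs from the `i`-th letter to the
cyclically next one; `(i, true)` is this edge in the direction of the curve and `(i, false)` is the
same edge backwards. -/
abbrev Dart (w : GaussCode α) := Fin w.length × Bool

/-- The position of the letter at which a dart ends. -/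
def Dart.head {w : GaussCode α} (d : Dart w) : Fin w.length :=
  if d.2 then finRotate _ d.1 else d.1

/-- The position of the letter at which a dart starts. -/
def Dart.tail {w : GaussCode α} (d : Dart w) : Fin w.length :=
  if d.2 then d.1 else finRotate _ d.1

/-- The dart `e` follows the dart `d` on the boundary of the face to the left of `d`: at the end of
`d` one turns left, onto the other strand of the crossing. At a letter with
`above = true` and positive sign, or `above = false` and negative sign, the other strand crosses
from right to left; otherwise it crosses from left to right. -/
def FaceStep (w : GaussCode α) (d e : Dart w) : Prop :=
  d.head ≠ e.tail ∧ (w.get d.head).crossing = (w.get e.tail).crossing ∧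
    e.2 = (d.2 == ((w.get d.head).above == decide ((w.get d.head).sign = 1)))

/-- The faces of the diagram: the orbits of darts under walking along the boundary of a face. -/
def Face (w : GaussCode α) : Type := Quot (FaceStep w)

/-- The code is that of a diagram on the sphere: with `V` crossings, `2 V` edges and `F` faces,
Euler's formula `V - 2 V + F = 2` holds. As a code with `V` crossings has `2 V` letters, this is
`2 F = length + 4`. -/
def IsPlanar (w : GaussCode α) : Prop :=
  w = [] ∨ (IsProper w ∧ 2 * Nat.card (Face w) = w.length + 4)

/-- The first and second Reidemeister moves in the direction that removes crossings, for crossings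
outside the set `B`. In `r1` a curl is removed. In `r2` and `r2'` two
strands bound a bigon whose corners are `a` and `b`, one strand is above at both of them, and the
strands are pulled apart; the strands run in parallel directions in `r2` and in opposite ones in
`r2'`. (The two corners of a bigon have opposite signs, and conversely opposite signs
make the two edges between `a` and `b` the boundary of a face.) -/
inductive Removal (B : Set α) : GaussCode α → GaussCode α → Prop
  | r1 (a : α) (ha : a ∉ B) (o : Bool) (s : ℤˣ) (u : GaussCode α) :
      Removal B ([⟨a, o, s⟩, ⟨a, !o, s⟩] ++ u) u
  | r2 (a b : α) (ha : a ∉ B) (hb : b ∉ B) (o : Bool) (s : ℤˣ) (u v : GaussCode α) :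
      Removal B ([⟨a, o, s⟩, ⟨b, o, -s⟩] ++ u ++ [⟨a, !o, s⟩, ⟨b, !o, -s⟩] ++ v) (u ++ v)
  | r2' (a b : α) (ha : a ∉ B) (hb : b ∉ B) (o : Bool) (s : ℤˣ) (u v : GaussCode α) :
      Removal B ([⟨a, o, s⟩, ⟨b, o, -s⟩] ++ u ++ [⟨b, !o, -s⟩, ⟨a, !o, s⟩] ++ v) (u ++ v)

/-- Two consecutive letters, `x` first if `d = 1` and `y` first if `d = -1`. -/
def arc (d : ℤˣ) (x y : Letter α) : GaussCode α :=
  if d = 1 then [x, y] else [y, x]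

/-- The third Reidemeister move, for crossings outside the set `B`. The top strand meets the middle
one in `a` and the bottom one in `b`, and these two meet in `c`. The letters
`p`, `q`, `r` say in which order the top strand meets `a, b`, the middle one `a, c` and the bottom
one `b, c`; the move reverses all three orders. The conditions on the signs of `a` and `b` say that
the edges between `a`, `b`, `c` bound a triangular face. The two constructors are the two cyclic
orders in which the curve can run through the three strands. -/
inductive Slide (B : Set α) : GaussCode α → GaussCode α → Prop
  | r3 (a b c : α) (ha : a ∉ B) (hb : b ∉ B) (hc : c ∉ B) (p q r s : ℤˣ) (u v t : GaussCode α) :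
      Slide B
        (arc p ⟨a, true, p * r * s⟩ ⟨b, true, p * q * s⟩ ++ u ++
          arc q ⟨a, false, p * r * s⟩ ⟨c, true, s⟩ ++ v ++
          arc r ⟨b, false, p * q * s⟩ ⟨c, false, s⟩ ++ t)
        (arc (-p) ⟨a, true, p * r * s⟩ ⟨b, true, p * q * s⟩ ++ u ++
          arc (-q) ⟨a, false, p * r * s⟩ ⟨c, true, s⟩ ++ v ++
          arc (-r) ⟨b, false, p * q * s⟩ ⟨c, false, s⟩ ++ t)
  | r3' (a b c : α) (ha : a ∉ B) (hb : b ∉ B) (hc : c ∉ B) (p q r s : ℤˣ) (u v t : GaussCode α) :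
      Slide B
        (arc p ⟨a, true, p * r * s⟩ ⟨b, true, p * q * s⟩ ++ u ++
          arc r ⟨b, false, p * q * s⟩ ⟨c, false, s⟩ ++ v ++
          arc q ⟨a, false, p * r * s⟩ ⟨c, true, s⟩ ++ t)
        (arc (-p) ⟨a, true, p * r * s⟩ ⟨b, true, p * q * s⟩ ++ u ++
          arc (-r) ⟨b, false, p * q * s⟩ ⟨c, false, s⟩ ++ v ++
          arc (-q) ⟨a, false, p * r * s⟩ ⟨c, true, s⟩ ++ t)

/-- A Reidemeister move of diagrams on the sphere in which only crossings outside `B` take part, or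
a change of the base point. Removals and slides lead from a planar diagram to a planar one; an
insertion of crossings is a move only if its result is planar (for the second
move: the two strands border a common face). With `B = ∅` these are all Reidemeister moves. -/
inductive Move (B : Set α) : GaussCode α → GaussCode α → Prop
  | rotate (u v : GaussCode α) : Move B (u ++ v) (v ++ u)
  | remove {w w' : GaussCode α} (h : Removal B w w') : Move B w w'
  | insert {w w' : GaussCode α} (h : Removal B w' w) (hp : IsPlanar w') : Move B w w'
  | slide {w w' : GaussCode α} (h : Slide B w w') : Move B w w'

/-- `w` can be turned into `w'` by Reidemeister moves in which no crossing of `B` takes part. -/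
def ReducesTo (B : Set α) (w w' : GaussCode α) : Prop :=
  Relation.ReflTransGen (Move B) w w'

end GaussCode

/-- The crossing points of the `(2n+1) × (2n+1)` lattice: (row, column), counted from `0` at the
upper left corner. -/
abbrev Node (n : ℕ) := Fin (2 * n + 1) × Fin (2 * n + 1)

namespace LatticeKnot

/-- A choice of one of the two crossing types at each node; `true` means that the horizontal line
passes over the vertical one. -/
abbrev Assignment (n : ℕ) := Node n → Bool

/-- The sign of the crossing at `p`. The curve runs along row `r` to the right iff `r` is even, and
along column `c` upwards iff `c` is even. -/
def nodeSign {n : ℕ} (x : Assignment n) (p : Node n) : ℤˣ :=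
  (if x p then 1 else -1) * (-1) ^ (p.1.val + p.2.val)

/-- The passage of the horizontal line through the node `p`. -/
def horizontal {n : ℕ} (x : Assignment n) (p : Node n) : Letter (ℕ × ℕ) :=
  ⟨(p.1, p.2), x p, nodeSign x p⟩

/-- The passage of the vertical line through the node `p`. -/
def vertical {n : ℕ} (x : Assignment n) (p : Node n) : Letter (ℕ × ℕ) :=
  ⟨(p.1, p.2), !x p, nodeSign x p⟩

/-- The lattice knot of the assignment `x`. The curve starts at the upper left corner and runs
through the rows from top to bottom, the first one to the right, the second one to the left, and
so on; from the right end of the last row it turns to the lower end of the last column and runs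
through the columns from right to left, the last one upwards, the one before it downwards, and so
on; the upper end of the first column is joined to the left end of the first row. -/
def code {n : ℕ} (x : Assignment n) : GaussCode (ℕ × ℕ) :=
  ((List.finRange (2 * n + 1)).flatMap fun r =>
      if Even r.val then (List.finRange (2 * n + 1)).map fun c => horizontal x (r, c)
      else (List.finRange (2 * n + 1)).reverse.map fun c => horizontal x (r, c)) ++
    (List.finRange (2 * n + 1)).reverse.flatMap fun c =>
      if Even c.val then (List.finRange (2 * n + 1)).reverse.map fun r => vertical x (r, c)
      else (List.finRange (2 * n + 1)).map fun r => vertical x (r, c)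

/-- The positions of a `(2k+1) × (2k+1)` block in the `(2n+1) × (2n+1)` lattice (`k ≤ n`): the block
at `(i, j)` has `2 i` rows above it and `2 j` columns to its left. -/
abbrev Position (n k : ℕ) := Fin (n - k + 1) × Fin (n - k + 1)

/-- The node of the lattice that is the node `q` of the block at position `s`. -/
def blockNode {n k : ℕ} (hkn : k ≤ n) (s : Position n k) (q : Node k) : Node n :=
  (⟨2 * s.1.val + q.1.val, by have := s.1.isLt; have := q.1.isLt; omega⟩,
    ⟨2 * s.2.val + q.2.val, by have := s.2.isLt; have := q.2.isLt; omega⟩)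

/-- The nodes outside the block. -/
abbrev Outer {n k : ℕ} (hkn : k ≤ n) (s : Position n k) :=
  {p : Node n // p ∉ Set.range (blockNode hkn s)}

/-- The names of the crossings of the block. -/
def blockCrossings {n k : ℕ} (s : Position n k) : Set (ℕ × ℕ) :=
  {p | (2 * s.1.val ≤ p.1 ∧ p.1 ≤ 2 * s.1.val + 2 * k) ∧
    (2 * s.2.val ≤ p.2 ∧ p.2 ≤ 2 * s.2.val + 2 * k)}

/-- The crossing types `t` outside the block at position `s` embed the `(2k+1) × (2k+1)` lattice
there: however the crossings of the block are chosen, Reidemeister moves in which only other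
crossings take part turn the big lattice knot into the lattice knot of the block. -/
def Embeds {n k : ℕ} (hkn : k ≤ n) (s : Position n k) (t : Outer hkn s → Bool) : Prop :=
  ∀ x : Assignment n, (∀ p : Outer hkn s, x p = t p) →
    GaussCode.ReducesTo (blockCrossings s) (code x)
      ((code fun q : Node k => x (blockNode hkn s q)).map
        (Letter.relabel fun p => (2 * s.1.val + p.1, 2 * s.2.val + p.2)))

/-- The `(2k+1) × (2k+1)` lattices inside the `(2n+1) × (2n+1)` lattice: a position together with
crossing types outside the block that embed the small lattice there. -/
abbrev Embedding {n k : ℕ} (hkn : k ≤ n) :=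
  {e : (s : Position n k) × (Outer hkn s → Bool) // Embeds hkn e.1 e.2}

end LatticeKnot

/-!
Consecutive rows of the lattice are joined to fingers, and so are consecutive columns. Where the
finger of the first two rows meets the finger of two columns joined at the top, there is a `2 × 2`
cell of crossings. If the crossing types in the cell agree along each row, the finger of the
columns can be pulled back through both rows by two second Reidemeister moves; if they agree along
each column, the finger of the rows can be pulled back through both columns in the same way. So 6
of the 16 choices allow the cell to be removed (`reduces_cell`). After the cells have been removed
from right to left, the two rows cross only the first column, and these two crossings are curls,
whatever their types are (`reduces_strip`). What remains is a lattice with two rows fewer.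

The lattice is symmetric: its transpose is the reflected and reversed curve, and turning it by
180° reverses the curve and moves the base point. Since removals are invariant under reflection
and reversal, pairs of rows or columns can be taken away on each of the four sides (`reduces_top`,
`reduces_bottom`, `reduces_left`, `reduces_right`). Taking away the rows above and below the block
first and the columns on its sides afterwards leads to the block (`reduces_block`), with
`N = (n - k) (n + k)` cells and `4 (n - k)` free crossings at the ends of the pairs. So at each
position at least `6 ^ N * 4 ^ (2 * (n - k))` choices embed the small lattice
(`card_position_mul_card_pattern_le`), while the claimed bound is `4 ^ N * 4 ^ (2 * (n - k))` plus
a term that is at most as large and vanishes for `n - k = 1` (`bound_lt`).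
-/

/-! ### Simplification of Gauss codes and its symmetries -/

namespace GaussCode

variable {α : Type*}

/-- `w` can be turned into `w'` by changes of the base point and by first and second Reidemeister
moves that remove crossings outside `B`. Unlike `ReducesTo` this relation is visibly invariant
under reversing the orientation and under reflecting the plane. -/
def Reduces (B : Set α) : GaussCode α → GaussCode α → Prop :=
  Relation.ReflTransGen fun w w' => w ~r w' ∨ Removal B w w'

theorem Reduces.reducesTo {B : Set α} {w w' : GaussCode α} (h : Reduces B w w') :
    ReducesTo B w w' := by
  induction h with
  | refl => exact .refl
  | @tail v _ _ h ih =>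
    refine ih.tail ?_
    rcases h with ⟨m, rfl⟩ | h
    · rw [List.rotate_eq_drop_append_take_mod]
      conv_lhs => rw [← List.take_append_drop (m % v.length) v]
      exact .rotate _ _
    · exact .remove h

theorem Reduces.of_eq {B : Set α} {w w' : GaussCode α} (h : w = w') : Reduces B w w' :=
  h ▸ .refl

theorem Reduces.trans {B : Set α} {u v w : GaussCode α} (h : Reduces B u v)
    (h' : Reduces B v w) : Reduces B u w :=
  Relation.ReflTransGen.trans h h'

theorem Reduces.of_isRotated {B : Set α} {w w' : GaussCode α} (h : w ~r w') : Reduces B w w' :=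
  .single (.inl h)

theorem Reduces.of_removal {B : Set α} {w w' : GaussCode α} (h : Removal B w w') :
    Reduces B w w' :=
  .single (.inr h)

theorem isRotated_of_eq_append {w w' u v : GaussCode α} (h : w = u ++ v) (h' : w' = v ++ u) :
    w ~r w' := by
  subst h h'
  exact List.isRotated_append

theorem Removal.reduces_of_isRotated {B : Set α} {w w' v v' : GaussCode α} (h : Removal B v v')
    (hw : w ~r v) (hw' : v' ~r w') : Reduces B w w' :=
  (Reduces.of_isRotated hw).trans ((Reduces.of_removal h).trans (.of_isRotated hw'))

/-- Reversing the curve keeps the signs of the crossings and exchanges the two passages through a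
curl or a bigon, so that the same moves apply. -/
theorem Removal.reduces_reverse {B : Set α} {w w' : GaussCode α} (h : Removal B w w') :
    Reduces B w.reverse w'.reverse := by
  cases h with
  | r1 a ha o s u =>
    refine (Removal.r1 a ha (!o) s w'.reverse).reduces_of_isRotated ?_ (.refl _)
    exact isRotated_of_eq_append (u := w'.reverse) (v := [_, _])
      (by simp; exact ⟨rfl, rfl⟩) (by simp)
  | r2 a b ha hb o s u v =>
    refine (Removal.r2 b a hb ha (!o) (-s) u.reverse v.reverse).reduces_of_isRotated ?_ ?_
    · exact isRotated_of_eq_append (u := v.reverse)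
        (v := [_, _] ++ u.reverse ++ [_, _]) (by simp; exact ⟨rfl, rfl, rfl, rfl⟩) (by simp)
    · exact isRotated_of_eq_append (u := u.reverse) (v := v.reverse) (by simp) (by simp)
  | r2' a b ha hb o s u v =>
    refine (Removal.r2' a b ha hb (!o) s u.reverse v.reverse).reduces_of_isRotated ?_ ?_
    · exact isRotated_of_eq_append (u := v.reverse)
        (v := [_, _] ++ u.reverse ++ [_, _]) (by simp; exact ⟨rfl, rfl, rfl, rfl⟩) (by simp)
    · exact isRotated_of_eq_append (u := u.reverse) (v := v.reverse) (by simp) (by simp)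

theorem Reduces.reverse {B : Set α} {w w' : GaussCode α} (h : Reduces B w w') :
    Reduces B w.reverse w'.reverse := by
  induction h with
  | refl => exact .refl
  | tail _ h ih =>
    exact ih.trans (h.elim (fun h => .of_isRotated h.reverse) Removal.reduces_reverse)

/-- The code of the diagram reflected in a line of the plane: over- and underpasses are kept and all
signs change. -/
def mirror (w : GaussCode α) : GaussCode α :=
  w.map fun x => ⟨x.crossing, x.above, -x.sign⟩

theorem Removal.mirror {B : Set α} {w w' : GaussCode α} (h : Removal B w w') :
    Removal B w.mirror w'.mirror := by
  cases h with
  | r1 a ha o s u => simpa [GaussCode.mirror] using Removal.r1 a ha o (-s) w'.mirror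
  | r2 a b ha hb o s u v =>
    simpa [GaussCode.mirror] using Removal.r2 a b ha hb o (-s) u.mirror v.mirror
  | r2' a b ha hb o s u v =>
    simpa [GaussCode.mirror] using Removal.r2' a b ha hb o (-s) u.mirror v.mirror

theorem Reduces.mirror {B : Set α} {w w' : GaussCode α} (h : Reduces B w w') :
    Reduces B w.mirror w'.mirror := by
  induction h with
  | refl => exact .refl
  | tail _ h ih =>
    exact ih.trans (h.elim (fun h => .of_isRotated (h.map _)) fun h => .of_removal h.mirror)

/-- The second move with parallel strands, applied at an arbitrary place of the code. -/
theorem reduces_r2 {B : Set α} {a b : α} (ha : a ∉ B) (hb : b ∉ B) (o : Bool) {s t : ℤˣ}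
    (hst : t = -s) (u v w : GaussCode α) :
    Reduces B (u ++ [⟨a, o, s⟩, ⟨b, o, t⟩] ++ v ++ [⟨a, !o, s⟩, ⟨b, !o, t⟩] ++ w)
      (u ++ v ++ w) := by
  subst hst
  refine (Removal.r2 a b ha hb o s v (w ++ u)).reduces_of_isRotated ?_ ?_
  · exact isRotated_of_eq_append (u := u) (v := [_, _] ++ v ++ [_, _] ++ w)
      (by simp; exact ⟨rfl, rfl, rfl, rfl⟩) (by simp)
  · exact isRotated_of_eq_append (u := v ++ w) (v := u) (by simp) (by simp)

/-- The second move with antiparallel strands, applied at an arbitrary place of the code. -/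
theorem reduces_r2' {B : Set α} {a b : α} (ha : a ∉ B) (hb : b ∉ B) (o : Bool) {s t : ℤˣ}
    (hst : t = -s) (u v w : GaussCode α) :
    Reduces B (u ++ [⟨a, o, s⟩, ⟨b, o, t⟩] ++ v ++ [⟨b, !o, t⟩, ⟨a, !o, s⟩] ++ w)
      (u ++ v ++ w) := by
  subst hst
  refine (Removal.r2' a b ha hb o s v (w ++ u)).reduces_of_isRotated ?_ ?_
  · exact isRotated_of_eq_append (u := u) (v := [_, _] ++ v ++ [_, _] ++ w)
      (by simp; exact ⟨rfl, rfl, rfl, rfl⟩) (by simp)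
  · exact isRotated_of_eq_append (u := v ++ w) (v := u) (by simp) (by simp)

end GaussCode

namespace LatticeKnot

open GaussCode

variable {α : Type*}

/-! ### Snakes through a rectangular array -/

/-- The letters `L r c` with `r ≤ 2 a` and `c ≤ 2 b`, read row by row, the even rows in increasing
and the odd ones in decreasing order of `c`. -/
def snake (a b : ℕ) (L : ℕ → ℕ → Letter α) : GaussCode α :=
  (List.range (2 * a + 1)).flatMap fun r =>
    if Even r then (List.range (2 * b + 1)).map (L r)
    else (List.range (2 * b + 1)).reverse.map (L r)

theorem snake_zero (b : ℕ) (L : ℕ → ℕ → Letter α) :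
    snake 0 b L = (List.range (2 * b + 1)).map (L 0) := by
  simp [snake]

theorem snake_succ (a b : ℕ) (L : ℕ → ℕ → Letter α) :
    snake (a + 1) b L = snake a b L ++ (List.range (2 * b + 1)).reverse.map (L (2 * a + 1)) ++
      (List.range (2 * b + 1)).map (L (2 * a + 2)) := by
  simp [snake, show 2 * (a + 1) + 1 = 2 * a + 1 + 1 + 1 by ring,
    List.range_succ (n := 2 * a + 1 + 1), List.range_succ (n := 2 * a + 1), parity_simps]

theorem range_two_mul_succ (a : ℕ) :
    List.range (2 * (a + 1) + 1) = [0, 1] ++ (List.range (2 * a + 1)).map (· + 2) := by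
  rw [show 2 * (a + 1) + 1 = 2 * a + 1 + 1 + 1 by ring, List.range_succ_eq_map,
    List.range_succ_eq_map]
  simp

theorem snake_succ' (a b : ℕ) (L : ℕ → ℕ → Letter α) :
    snake (a + 1) b L = (List.range (2 * b + 1)).map (L 0) ++
      (List.range (2 * b + 1)).reverse.map (L 1) ++ snake a b fun r => L (r + 2) := by
  simp [snake, range_two_mul_succ, List.flatMap_map, parity_simps]

theorem snake_congr {a b : ℕ} {L L' : ℕ → ℕ → Letter α}
    (h : ∀ r ≤ 2 * a, ∀ c ≤ 2 * b, L r c = L' r c) : snake a b L = snake a b L' := by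
  unfold snake
  refine List.flatMap_congr fun r hr => ?_
  have hr : r ≤ 2 * a := by simpa [Nat.lt_succ_iff] using hr
  split_ifs <;> refine List.map_congr_left fun c hc => h r hr c ?_ <;>
    simpa [Nat.lt_succ_iff] using hc

theorem reverse_range (m : ℕ) :
    (List.range (m + 1)).reverse = (List.range (m + 1)).map fun r => m - r := by
  apply List.ext_getElem <;> simp

/-- As `2 a` is even, a snake read backwards is the snake of the index box turned by 180°. -/
theorem snake_reverse (a b : ℕ) (L : ℕ → ℕ → Letter α) :
    (snake a b L).reverse = snake a b fun r c => L (2 * a - r) (2 * b - c) := by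
  unfold snake
  rw [List.reverse_flatMap, reverse_range (2 * a), List.flatMap_map]
  refine List.flatMap_congr fun r hr => ?_
  have hr : r ≤ 2 * a := by simpa [Nat.lt_succ_iff] using hr
  have : Even (2 * a - r) ↔ Even r := by simp [Nat.even_sub hr]
  by_cases h : Even r
  · simp [this, h, ← List.map_reverse, reverse_range (2 * b)]
  · simp only [Function.comp, this, h, if_false, ← List.map_reverse,
      reverse_range (2 * b), List.map_map]
    refine List.map_congr_left fun c hc => ?_
    have hc : c ≤ 2 * b := by simpa [Nat.lt_succ_iff] using hc
    simp [Nat.sub_sub_self hc]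

/-! ### Rectangular lattices and the retraction of their first two rows -/

/-- The sign of the crossing in row `r` and column `c` if the row passes over the column
(`o = true`) or under it. -/
def gridSign (o : Bool) (r c : ℕ) : ℤˣ :=
  (if o then 1 else -1) * (-1) ^ (r + c)

/-- The passage of row `r` through the crossing called `ν r c`; `X r c` says whether the row is
above. -/
def rowPass (ν : ℕ → ℕ → α) (X : ℕ → ℕ → Bool) (r c : ℕ) : Letter α :=
  ⟨ν r c, X r c, gridSign (X r c) r c⟩

/-- The passage of column `c` through the crossing called `ν r c`. The column is the first index, so
that the columns, too, are read by `snake`. -/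
def colPass (ν : ℕ → ℕ → α) (X : ℕ → ℕ → Bool) (c r : ℕ) : Letter α :=
  ⟨ν r c, !X r c, gridSign (X r c) r c⟩

/-- The lattice knot with `2 a + 1` rows and `2 b + 1` columns, crossing names `ν` and crossing
types `X`. The columns are traversed exactly opposite to the snake that starts in column `0` at row
`0`. -/
def grid (a b : ℕ) (ν : ℕ → ℕ → α) (X : ℕ → ℕ → Bool) : GaussCode α :=
  snake a b (rowPass ν X) ++ (snake b a (colPass ν X)).reverse

/-- The condition on the crossing types of a `2 × 2` cell `p q / r s` under which a finger of two
joined rows and a finger of two joined columns that cross in it come apart: the types agree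
along each row or along each column. This holds for 6 of the 16 choices. -/
def RemovableCell (p q r s : Bool) : Prop :=
  (p = q ∧ r = s) ∨ (p = r ∧ q = s)

/-- A removable cell in the first two rows can be removed if its four passages are consecutive
both in the rows and in the columns, that is, if the two rows are joined just to the right of it
and the two columns just above it. -/
theorem reduces_cell {B : Set α} (ν : ℕ → ℕ → α) (X : ℕ → ℕ → Bool) (c : ℕ)
    (hν : ∀ r < 2, ∀ c, ν r c ∉ B) (h : RemovableCell (X 0 c) (X 0 (c + 1)) (X 1 c) (X 1 (c + 1)))
    (u v w : GaussCode α) :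
    Reduces B
      (u ++ [rowPass ν X 0 c, rowPass ν X 0 (c + 1), rowPass ν X 1 (c + 1), rowPass ν X 1 c] ++ v ++
        [colPass ν X (c + 1) 1, colPass ν X (c + 1) 0, colPass ν X c 0, colPass ν X c 1] ++ w)
      (u ++ v ++ w) := by
  have h0 := hν 0 (by norm_num)
  have h1 := hν 1 (by norm_num)
  rcases h with ⟨h, h'⟩ | ⟨h, h'⟩
  -- Pull the finger of the two columns out of the first row, then out of the second one.
  · have e := reduces_r2' (h0 c) (h0 (c + 1)) (X 0 c) (s := gridSign (X 0 c) 0 c)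
      (t := gridSign (X 0 c) 0 (c + 1)) (by simp [gridSign, pow_succ]) u
      ([rowPass ν X 1 (c + 1), rowPass ν X 1 c] ++ v ++ [colPass ν X (c + 1) 1])
      ([colPass ν X c 1] ++ w)
    have e' := reduces_r2 (h1 (c + 1)) (h1 c) (X 1 c) (s := gridSign (X 1 c) 1 (c + 1))
      (t := gridSign (X 1 c) 1 c) (by simp [gridSign, pow_add]) u v w
    refine Reduces.trans ?_ (e.trans (Reduces.trans ?_ e'))
    all_goals exact .of_eq (by simp [rowPass, colPass, ← h, ← h'])
  -- Pull the finger of the two rows out of the column `c + 1`, then out of the column `c`.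
  · have e := reduces_r2' (h0 (c + 1)) (h1 (c + 1)) (X 0 (c + 1))
      (s := gridSign (X 0 (c + 1)) 0 (c + 1))
      (t := gridSign (X 0 (c + 1)) 1 (c + 1)) (by simp [gridSign, pow_add])
      (u ++ [rowPass ν X 0 c])
      ([rowPass ν X 1 c] ++ v) ([colPass ν X c 0, colPass ν X c 1] ++ w)
    have e' := reduces_r2 (h0 c) (h1 c) (X 0 c) (s := gridSign (X 0 c) 0 c)
      (t := gridSign (X 0 c) 1 c) (by simp [gridSign, pow_add]) u v w
    refine Reduces.trans ?_ (e.trans (Reduces.trans ?_ e'))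
    all_goals exact .of_eq (by simp [rowPass, colPass, ← h, ← h'])

/-- The first two rows are retracted through the columns up to `2 m` when they have already left the
columns further to the right. The cells go one by one from right to left. Once only column `0` is
left, its crossings with both rows are curls, because the upper end of column `0` is joined to the
left end of row `0`. The list `u` collects the rest of the curve between the second row and the
columns up to `2 m`. -/
theorem reduces_strip {B : Set α} (a : ℕ) (ν : ℕ → ℕ → α) (X : ℕ → ℕ → Bool)
    (hν : ∀ r < 2, ∀ c, ν r c ∉ B) (m : ℕ)
    (h : ∀ c < m, RemovableCell (X 0 (2 * c + 1)) (X 0 (2 * c + 2))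
      (X 1 (2 * c + 1)) (X 1 (2 * c + 2)))
    (u : GaussCode α) :
    Reduces B ((List.range (2 * m + 1)).map (rowPass ν X 0) ++
        (List.range (2 * m + 1)).reverse.map (rowPass ν X 1) ++ u ++
          (snake m (a + 1) (colPass ν X)).reverse)
      (u ++ (snake m a fun c r => colPass ν X c (r + 2)).reverse) := by
  induction m generalizing u with
  | zero =>
    have hr (x : Letter α) (w : GaussCode α) : w ++ [x] ~r x :: w :=
      isRotated_of_eq_append rfl (by simp)
    set v := u ++ (snake 0 a fun c r => colPass ν X c (r + 2)).reverse with hv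
    have e : (List.range (2 * 0 + 1)).map (rowPass ν X 0) ++
        (List.range (2 * 0 + 1)).reverse.map (rowPass ν X 1) ++ u ++
          (snake 0 (a + 1) (colPass ν X)).reverse =
        [rowPass ν X 0 0, rowPass ν X 1 0] ++ (v ++ [colPass ν X 0 1]) ++ [colPass ν X 0 0] := by
      simp [hv, snake_zero, range_two_mul_succ, Function.comp_def]
    rw [e]
    have e0 := Removal.r1 _ (hν 0 (by norm_num) 0) (!X 0 0) (gridSign (X 0 0) 0 0)
      (rowPass ν X 1 0 :: (v ++ [colPass ν X 0 1]))
    have e1 := Removal.r1 _ (hν 1 (by norm_num) 0) (!X 1 0) (gridSign (X 1 0) 1 0) v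
    refine (Reduces.of_isRotated (hr _ _)).trans (Reduces.trans ?_ ((Reduces.of_removal e0).trans
      ((Reduces.of_isRotated (hr _ (_ :: _))).trans (Reduces.trans ?_ (Reduces.of_removal e1)))))
    all_goals exact .of_eq (by simp [rowPass, colPass])
  | succ m ih =>
    have e := reduces_cell ν X (2 * m + 1) hν (h m (by simp))
      ((List.range (2 * m + 1)).map (rowPass ν X 0))
      ((List.range (2 * m + 1)).reverse.map (rowPass ν X 1) ++ u ++
        ((List.range (2 * a + 1)).map fun r => colPass ν X (2 * m + 2) (r + 2)).reverse)
      (((List.range (2 * a + 1)).map fun r => colPass ν X (2 * m + 1) (r + 2)) ++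
        (snake m (a + 1) (colPass ν X)).reverse)
    have e' := ih (fun c hc => h c (by omega)) (u ++
      ((List.range (2 * a + 1)).map fun r => colPass ν X (2 * m + 2) (r + 2)).reverse ++
      ((List.range (2 * a + 1)).map fun r => colPass ν X (2 * m + 1) (r + 2)))
    refine Reduces.trans ?_ (e.trans (Reduces.trans ?_ (e'.trans ?_)))
    · rw [snake_succ, range_two_mul_succ a, show 2 * (m + 1) + 1 = 2 * m + 1 + 1 + 1 by ring,
        List.range_succ (n := 2 * m + 1 + 1), List.range_succ (n := 2 * m + 1)]
      exact .of_eq (by simp [Function.comp_def])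
    · exact .of_eq (by simp)
    · exact .of_eq (by simp [snake_succ])

/-! ### Symmetries of the lattice and retraction on all four sides -/

theorem grid_congr {a b : ℕ} {ν ν' : ℕ → ℕ → α} {X X' : ℕ → ℕ → Bool}
    (hν : ∀ r ≤ 2 * a, ∀ c ≤ 2 * b, ν r c = ν' r c)
    (hX : ∀ r ≤ 2 * a, ∀ c ≤ 2 * b, X r c = X' r c) : grid a b ν X = grid a b ν' X' := by
  unfold grid
  congr 1
  · exact snake_congr fun r hr c hc => by simp [rowPass, hν r hr c hc, hX r hr c hc]
  · congr 1
    exact snake_congr fun c hc r hr => by simp [colPass, hν r hr c hc, hX r hr c hc]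

theorem mirror_snake (a b : ℕ) (L : ℕ → ℕ → Letter α) :
    mirror (snake a b L) =
      snake a b fun r c => ⟨(L r c).crossing, (L r c).above, -(L r c).sign⟩ := by
  simp only [mirror, snake, List.map_flatMap]
  refine List.flatMap_congr fun r _ => ?_
  split_ifs <;> simp [Function.comp_def]

theorem gridSign_not (o : Bool) (r c : ℕ) : gridSign (!o) c r = -gridSign o r c := by
  cases o <;> simp [gridSign, add_comm]

/-- Transposing the lattice reflects the plane and reverses the curve. -/
theorem mirror_reverse_grid (a b : ℕ) (ν : ℕ → ℕ → α) (X : ℕ → ℕ → Bool) :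
    mirror (grid a b ν X).reverse = grid b a (fun c r => ν r c) fun c r => !X r c := by
  rw [grid, List.reverse_append, List.reverse_reverse, mirror, List.map_append, List.map_reverse]
  change mirror _ ++ (mirror _).reverse = _
  rw [mirror_snake, mirror_snake, grid]
  congr 2
  · ext r c
    simp [rowPass, colPass, gridSign_not]
  · congr 1
    ext r c
    simp [rowPass, colPass, gridSign_not]

theorem gridSign_sub (o : Bool) {a b r c : ℕ} (hr : r ≤ 2 * a) (hc : c ≤ 2 * b) :
    gridSign o (2 * a - r) (2 * b - c) = gridSign o r c := by
  have h : Even (2 * a - r + (2 * b - c)) ↔ Even (r + c) := by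
    simp [Nat.even_add, Nat.even_sub hr, Nat.even_sub hc]
  by_cases he : Even (r + c)
  · simp [gridSign, he.neg_one_pow, (h.2 he).neg_one_pow]
  · simp [gridSign, (Nat.not_even_iff_odd.1 he).neg_one_pow,
      (Nat.not_even_iff_odd.1 (mt h.1 he)).neg_one_pow]

/-- Turning the lattice by 180° reverses the curve and moves its base point to the opposite
corner. -/
theorem reverse_grid (a b : ℕ) (ν : ℕ → ℕ → α) (X : ℕ → ℕ → Bool) :
    (grid a b ν X).reverse ~r grid a b (fun r c => ν (2 * a - r) (2 * b - c))
      fun r c => X (2 * a - r) (2 * b - c) := by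
  refine isRotated_of_eq_append (u := snake b a (colPass ν X))
    (v := (snake a b (rowPass ν X)).reverse)
    (by simp [grid]) ?_
  have hr : (snake a b (rowPass ν X)).reverse = snake a b (rowPass
      (fun r c => ν (2 * a - r) (2 * b - c)) fun r c => X (2 * a - r) (2 * b - c)) :=
    (snake_reverse a b _).trans (snake_congr fun r hr c hc => by
      simp [rowPass, gridSign_sub _ hr hc])
  have hc : (snake b a (colPass ν X)).reverse = snake b a (colPass
      (fun r c => ν (2 * a - r) (2 * b - c)) fun r c => X (2 * a - r) (2 * b - c)) :=
    (snake_reverse b a _).trans (snake_congr fun c hc r hr => by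
      simp [colPass, gridSign_sub _ hr hc])
  rw [grid, ← hr, ← hc, List.reverse_reverse]

theorem reduces_transpose {B : Set α} {a b a' b' : ℕ} {ν ν' : ℕ → ℕ → α} {X X' : ℕ → ℕ → Bool}
    (h : Reduces B (grid a b ν X) (grid a' b' ν' X')) :
    Reduces B (grid b a (fun c r => ν r c) fun c r => !X r c)
      (grid b' a' (fun c r => ν' r c) fun c r => !X' r c) := by
  rw [← mirror_reverse_grid, ← mirror_reverse_grid]
  exact h.reverse.mirror

theorem reduces_rotate {B : Set α} {a b a' b' : ℕ} {ν ν' : ℕ → ℕ → α} {X X' : ℕ → ℕ → Bool}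
    (h : Reduces B (grid a b ν X) (grid a' b' ν' X')) :
    Reduces B (grid a b (fun r c => ν (2 * a - r) (2 * b - c)) fun r c => X (2 * a - r) (2 * b - c))
      (grid a' b' (fun r c => ν' (2 * a' - r) (2 * b' - c))
        fun r c => X' (2 * a' - r) (2 * b' - c)) :=
  (Reduces.of_isRotated (reverse_grid a b ν X).symm).trans
    (h.reverse.trans (.of_isRotated (reverse_grid a' b' ν' X')))

theorem RemovableCell.not {p q r s : Bool} (h : RemovableCell p q r s) :
    RemovableCell (!p) (!q) (!r) (!s) := by
  simpa [RemovableCell] using h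

theorem RemovableCell.transpose {p q r s : Bool} (h : RemovableCell p q r s) :
    RemovableCell p r q s :=
  h.symm

theorem RemovableCell.rotate {p q r s : Bool} (h : RemovableCell p q r s) :
    RemovableCell s r q p := by
  unfold RemovableCell at *
  tauto

/-- Retraction of the first `2 d` rows, two at a time. The cells lie in the columns `2 c + 1` and
`2 c + 2`, which are joined at the top. -/
theorem reduces_top {B : Set α} (a b d : ℕ) (ν : ℕ → ℕ → α) (X : ℕ → ℕ → Bool)
    (hν : ∀ r < 2 * d, ∀ c, ν r c ∉ B)
    (h : ∀ r < d, ∀ c < b, RemovableCell (X (2 * r) (2 * c + 1)) (X (2 * r) (2 * c + 2))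
      (X (2 * r + 1) (2 * c + 1)) (X (2 * r + 1) (2 * c + 2))) :
    Reduces B (grid (a + d) b ν X)
      (grid a b (fun r => ν (r + 2 * d)) fun r => X (r + 2 * d)) := by
  induction d generalizing ν X with
  | zero => exact .refl
  | succ d ih =>
    have e := reduces_strip (a + d) ν X (fun r hr => hν r (by omega)) b (h 0 (by omega))
      (snake (a + d) b fun r => rowPass ν X (r + 2))
    have hs (o : Bool) (r c : ℕ) : gridSign o (r + 2) c = gridSign o r c := by
      simp [gridSign, pow_add]
    refine Reduces.trans (.of_eq ?_) (e.trans (Reduces.trans (.of_eq ?_)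
      ((ih (fun r => ν (r + 2)) (fun r => X (r + 2)) (fun r hr => hν (r + 2) (by omega))
        fun r hr => h (r + 1) (by omega)).trans (.of_eq ?_))))
    · rw [grid, ← add_assoc, snake_succ']
    · have hr : rowPass (fun r => ν (r + 2)) (fun r => X (r + 2)) =
          fun r => rowPass ν X (r + 2) := by
        ext r c
        simp [rowPass, hs]
      have hc : colPass (fun r => ν (r + 2)) (fun r => X (r + 2)) =
          fun c r => colPass ν X c (r + 2) := by
        ext c r
        simp [colPass, hs]
      rw [grid, hr, hc]
    · exact grid_congr (fun r _ c _ => by ring_nf) fun r _ c _ => by ring_nf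

/-- Retraction of the last `2 d` rows, obtained from `reduces_top` by a rotation. The cells lie in
the columns `2 c` and `2 c + 1`, which are joined at the bottom. -/
theorem reduces_bottom {B : Set α} (a b d : ℕ) (ν : ℕ → ℕ → α) (X : ℕ → ℕ → Bool)
    (hν : ∀ r > 2 * a, ∀ c, ν r c ∉ B)
    (h : ∀ r, a ≤ r → r < a + d → ∀ c < b, RemovableCell
      (X (2 * r + 1) (2 * c)) (X (2 * r + 1) (2 * c + 1))
      (X (2 * r + 2) (2 * c)) (X (2 * r + 2) (2 * c + 1))) :
    Reduces B (grid (a + d) b ν X) (grid a b ν X) := by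
  have e := reduces_top (B := B) a b d (fun r c => ν (2 * (a + d) - r) (2 * b - c))
    (fun r c => X (2 * (a + d) - r) (2 * b - c)) (fun r hr c => hν _ (by omega) _)
    fun r hr c hc => by
      have := (h (a + d - 1 - r) (by omega) (by omega) (b - 1 - c) (by omega)).rotate
      convert this using 2 <;> omega
  refine Reduces.trans (.of_eq (grid_congr ?_ ?_)) ((reduces_rotate e).trans
    (.of_eq (grid_congr ?_ ?_))) <;> intro r hr c hc <;> congr 1 <;> omega

/-- Retraction of the first `2 d` columns, obtained from `reduces_top` by a transposition. -/
theorem reduces_left {B : Set α} (a b d : ℕ) (ν : ℕ → ℕ → α) (X : ℕ → ℕ → Bool)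
    (hν : ∀ r, ∀ c < 2 * d, ν r c ∉ B)
    (h : ∀ c < d, ∀ r < a, RemovableCell (X (2 * r + 1) (2 * c)) (X (2 * r + 1) (2 * c + 1))
      (X (2 * r + 2) (2 * c)) (X (2 * r + 2) (2 * c + 1))) :
    Reduces B (grid a (b + d) ν X)
      (grid a b (fun r c => ν r (c + 2 * d)) fun r c => X r (c + 2 * d)) := by
  have e := reduces_transpose (reduces_top (B := B) b a d (fun c r => ν r c) (fun c r => !X r c)
    (fun c hc r => hν r c hc) fun c hc r hr => (h c hc r hr).transpose.not)
  simpa using e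

/-- Retraction of the last `2 d` columns, obtained from `reduces_bottom` by a transposition. -/
theorem reduces_right {B : Set α} (a b d : ℕ) (ν : ℕ → ℕ → α) (X : ℕ → ℕ → Bool)
    (hν : ∀ r, ∀ c > 2 * b, ν r c ∉ B)
    (h : ∀ c, b ≤ c → c < b + d → ∀ r < a, RemovableCell
      (X (2 * r) (2 * c + 1)) (X (2 * r) (2 * c + 2))
      (X (2 * r + 1) (2 * c + 1)) (X (2 * r + 1) (2 * c + 2))) :
    Reduces B (grid a (b + d) ν X) (grid a b ν X) := by
  have e := reduces_transpose (reduces_bottom (B := B) b a d (fun c r => ν r c) (fun c r => !X r c)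
    (fun c hc r => hν r c hc) fun c hc hc' r hr => (h c hc hc' r hr).transpose.not)
  simpa using e

/-! ### From the lattice knot to its block -/

/-- The crossing type in row `r` and column `c`, for indices in `ℕ`; `false` outside the lattice,
where it plays no role. -/
def typeAt {n : ℕ} (x : Assignment n) (r c : ℕ) : Bool :=
  if h : r < 2 * n + 1 ∧ c < 2 * n + 1 then x (⟨r, h.1⟩, ⟨c, h.2⟩) else false

theorem typeAt_val {n : ℕ} (x : Assignment n) (p : Node n) : typeAt x p.1 p.2 = x p := by
  have h1 := p.1.isLt
  have h2 := p.2.isLt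
  simp [typeAt, h1, h2, -Order.lt_add_one_iff]

theorem snake_finRange {n : ℕ} (L : ℕ → ℕ → Letter α) {L' : Node n → Letter α}
    (h : ∀ p : Node n, L p.1 p.2 = L' p) :
    ((List.finRange (2 * n + 1)).flatMap fun r =>
      if Even r.val then (List.finRange (2 * n + 1)).map fun c => L' (r, c)
      else (List.finRange (2 * n + 1)).reverse.map fun c => L' (r, c)) = snake n n L := by
  simp only [snake, ← List.map_coe_finRange_eq_range, List.flatMap_map, ← h, List.map_map,
    ← List.map_reverse, Function.comp_def]

theorem code_eq_grid {n : ℕ} (x : Assignment n) :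
    code x = grid n n (fun r c => (r, c)) (typeAt x) := by
  have hr (p : Node n) : rowPass (fun r c => (r, c)) (typeAt x) p.1 p.2 = horizontal x p := by
    simp [rowPass, horizontal, typeAt_val, nodeSign, gridSign]
  have hc (p : Node n) :
      colPass (fun r c => (r, c)) (typeAt x) p.1 p.2 = vertical x (p.2, p.1) := by
    simp [colPass, vertical, typeAt_val x (p.2, p.1), nodeSign, gridSign]
  rw [code, grid, ← snake_finRange _ hr, ← snake_finRange _ hc, List.reverse_flatMap]
  congr 1
  refine List.flatMap_congr fun c _ => ?_
  simp only [Function.comp]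
  split_ifs <;> simp

theorem relabel_grid {β : Type*} (f : α → β) (a b : ℕ) (ν : ℕ → ℕ → α) (X : ℕ → ℕ → Bool) :
    (grid a b ν X).map (Letter.relabel f) = grid a b (fun r c => f (ν r c)) X := by
  simp only [grid, List.map_append, List.map_reverse, snake, List.map_flatMap]
  congr 1
  · refine List.flatMap_congr fun r _ => ?_
    split_ifs <;> simp [Function.comp_def, Letter.relabel, rowPass]
  · congr 1
    refine List.flatMap_congr fun r _ => ?_
    split_ifs <;> simp [Function.comp_def, Letter.relabel, colPass]

/-- All `2 × 2` cells outside the block are removable: first those in the pairs of rows above and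
below the block, over the full width of the lattice, then those in the pairs of columns to the left
and to the right of the block, at the height of the block only. The pairs of rows below the block
are counted from `s.1` on, and so are the pairs of columns to its right from `s.2` on. -/
def OuterCellsRemovable {n k : ℕ} (s : Position n k) (X : ℕ → ℕ → Bool) : Prop :=
  (∀ r < n - k, ∀ c < n,
      if r < s.1.val then
        RemovableCell (X (2 * r) (2 * c + 1)) (X (2 * r) (2 * c + 2))
          (X (2 * r + 1) (2 * c + 1)) (X (2 * r + 1) (2 * c + 2))
      else
        RemovableCell (X (2 * k + 2 * r + 1) (2 * c)) (X (2 * k + 2 * r + 1) (2 * c + 1))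
          (X (2 * k + 2 * r + 2) (2 * c)) (X (2 * k + 2 * r + 2) (2 * c + 1))) ∧
    ∀ c < n - k, ∀ r < k,
      if c < s.2.val then
        RemovableCell (X (2 * s.1.val + 2 * r + 1) (2 * c))
          (X (2 * s.1.val + 2 * r + 1) (2 * c + 1))
          (X (2 * s.1.val + 2 * r + 2) (2 * c)) (X (2 * s.1.val + 2 * r + 2) (2 * c + 1))
      else
        RemovableCell (X (2 * s.1.val + 2 * r) (2 * k + 2 * c + 1))
          (X (2 * s.1.val + 2 * r) (2 * k + 2 * c + 2))
          (X (2 * s.1.val + 2 * r + 1) (2 * k + 2 * c + 1))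
          (X (2 * s.1.val + 2 * r + 1) (2 * k + 2 * c + 2))

/-- If all outer cells are removable, the rows below and above the block are retracted, and then the
columns to its right and to its left. -/
theorem reduces_block {n k : ℕ} (hkn : k ≤ n) (s : Position n k) (x : Assignment n)
    (h : OuterCellsRemovable s (typeAt x)) :
    Reduces (blockCrossings s) (code x)
      ((code fun q : Node k => x (blockNode hkn s q)).map
        (Letter.relabel fun p => (2 * s.1.val + p.1, 2 * s.2.val + p.2))) := by
  obtain ⟨⟨i, hi⟩, ⟨j, hj⟩⟩ := s
  obtain ⟨h1, h2⟩ := h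
  obtain ⟨m, rfl⟩ := Nat.exists_eq_add_of_le hkn
  obtain ⟨d, rfl⟩ : ∃ d, m = i + d := Nat.exists_eq_add_of_le (by omega)
  obtain ⟨e, he⟩ : ∃ e, i + d = j + e := Nat.exists_eq_add_of_le (by omega)
  rw [code_eq_grid, code_eq_grid, relabel_grid]
  dsimp only at h1 h2 ⊢
  set B := blockCrossings (n := k + (i + d)) (k := k) (⟨i, hi⟩, ⟨j, hj⟩) with hB
  have hbottom := reduces_bottom (B := B) (k + i) (k + (i + d)) d (fun r c => (r, c)) (typeAt x)
    (fun r hr c => by simp only [hB, blockCrossings, Set.mem_ofPred_eq]; omega)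
    fun r hr hr' c hc => by
      have := h1 (r - k) (by omega) c hc
      rw [if_neg (by omega)] at this
      convert this using 2 <;> omega
  have htop := reduces_top (B := B) k (k + (i + d)) i (fun r c => (r, c)) (typeAt x)
    (fun r hr c => by simp only [hB, blockCrossings, Set.mem_ofPred_eq]; omega)
    fun r hr c hc => by simpa [hr] using h1 r (by omega) c hc
  have hright := reduces_right (B := B) k (k + j) e (fun r c => (r + 2 * i, c))
    (fun r => typeAt x (r + 2 * i))
    (fun r c hc => by simp only [hB, blockCrossings, Set.mem_ofPred_eq]; omega)
    fun c hc hc' r hr => by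
      have := h2 (c - k) (by omega) r hr
      rw [if_neg (by omega)] at this
      convert this using 2 <;> omega
  have hleft := reduces_left (B := B) k k j (fun r c => (r + 2 * i, c))
    (fun r => typeAt x (r + 2 * i))
    (fun r c hc => by simp only [hB, blockCrossings, Set.mem_ofPred_eq]; omega)
    fun c hc r hr => by
      have := h2 c (by omega) r hr
      rw [if_pos hc] at this
      convert this using 2 <;> omega
  rw [add_assoc] at hbottom hright
  rw [← he] at hright
  refine hbottom.trans (htop.trans (hright.trans (hleft.trans (.of_eq (grid_congr ?_ ?_)))))
  · intro r _ c _
    simp [add_comm]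
  · intro r hr c hc
    have e := typeAt_val (fun q : Node k => x (blockNode hkn (⟨i, hi⟩, ⟨j, hj⟩) q))
      (⟨r, by omega⟩, ⟨c, by omega⟩)
    have e' := typeAt_val x (blockNode hkn (⟨i, hi⟩, ⟨j, hj⟩) (⟨r, by omega⟩, ⟨c, by omega⟩))
    rw [← e'] at e
    rw [e]
    simp [blockNode, add_comm]

/-! ### Counting the choices outside the block -/

instance (p q r s : Bool) : Decidable (RemovableCell p q r s) :=
  inferInstanceAs (Decidable (_ ∨ _))

/-- The choices of crossing types in a cell that make it removable. -/
abbrev CellTypes := {g : Fin 2 → Fin 2 → Bool // RemovableCell (g 0 0) (g 0 1) (g 1 0) (g 1 1)}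

theorem card_cellTypes : Nat.card CellTypes = 6 := by
  rw [Nat.card_eq_fintype_card]
  decide

/-- Labels for the outer crossings, with `m = n - k`: those in the cells of the row pairs, those in
the cells of the column pairs, and the two free crossings at the end of each row pair and of each
column pair, which become curls. -/
abbrev Slot (m n k : ℕ) :=
  (Fin m × Fin n × Fin 2 × Fin 2) ⊕ (Fin m × Fin k × Fin 2 × Fin 2) ⊕
    (Fin m × Fin 2) ⊕ (Fin m × Fin 2)

/-- The row and the column of the crossing with a given label. -/
def slotNode {n k : ℕ} (s : Position n k) : Slot (n - k) n k → ℕ × ℕ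
  | .inl (r, c, u, v) =>
    if r.val < s.1.val then (2 * r + u, 2 * c + 1 + v) else (2 * k + 2 * r + 1 + u, 2 * c + v)
  | .inr (.inl (c, r, u, v)) =>
    if c.val < s.2.val then (2 * s.1.val + 2 * r + 1 + u, 2 * c + v)
    else (2 * s.1.val + 2 * r + u, 2 * k + 2 * c + 1 + v)
  | .inr (.inr (.inl (r, u))) =>
    if r.val < s.1.val then (2 * r + u, 0) else (2 * k + 2 * r + 1 + u, 2 * n)
  | .inr (.inr (.inr (c, v))) =>
    if c.val < s.2.val then (2 * s.1.val, 2 * c + v)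
    else (2 * s.1.val + 2 * k, 2 * k + 2 * c + 1 + v)

theorem slotNode_injective {n k : ℕ} (s : Position n k) : Function.Injective (slotNode s) := by
  rintro (⟨r, c, u, v⟩ | ⟨c, r, u, v⟩ | ⟨r, u⟩ | ⟨c, v⟩)
    (⟨r', c', u', v'⟩ | ⟨c', r', u', v'⟩ | ⟨r', u'⟩ | ⟨c', v'⟩) h <;>
  simp only [slotNode] at h <;> split_ifs at h <;>
  simp only [Prod.mk.injEq, Sum.inl.injEq, Sum.inr.injEq, reduceCtorEq, Fin.ext_iff] at h ⊢ <;>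
  omega

theorem slotNode_lt {n k : ℕ} (hkn : k ≤ n) (s : Position n k) (y : Slot (n - k) n k) :
    (slotNode s y).1 < 2 * n + 1 ∧ (slotNode s y).2 < 2 * n + 1 := by
  have := s.1.isLt
  have := s.2.isLt
  rcases y with ⟨r, c, u, v⟩ | ⟨c, r, u, v⟩ | ⟨r, u⟩ | ⟨c, v⟩ <;>
  simp only [slotNode] <;> split_ifs <;> dsimp only <;> omega

theorem slotNode_notMem {n k : ℕ} (s : Position n k) (y : Slot (n - k) n k)
    (q : Node k) :
    ¬((slotNode s y).1 = 2 * s.1.val + q.1.val ∧ (slotNode s y).2 = 2 * s.2.val + q.2.val) := by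
  have := s.1.isLt
  have := s.2.isLt
  have := q.1.isLt
  have := q.2.isLt
  rcases y with ⟨r, c, u, v⟩ | ⟨c, r, u, v⟩ | ⟨r, u⟩ | ⟨c, v⟩ <;>
  simp only [slotNode] <;> split_ifs <;> dsimp only <;> omega

/-- The outer crossing with a given label. -/
def slotOuter {n k : ℕ} (hkn : k ≤ n) (s : Position n k) (y : Slot (n - k) n k) : Outer hkn s :=
  ⟨(⟨(slotNode s y).1, (slotNode_lt hkn s y).1⟩, ⟨(slotNode s y).2, (slotNode_lt hkn s y).2⟩), by
    rintro ⟨q, hq⟩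
    simp only [blockNode, Prod.ext_iff, Fin.ext_iff] at hq
    exact slotNode_notMem s y q ⟨hq.1.symm, hq.2.symm⟩⟩

theorem slotOuter_injective {n k : ℕ} (hkn : k ≤ n) (s : Position n k) :
    Function.Injective (slotOuter hkn s) := by
  intro y y' h
  simp only [slotOuter, Subtype.mk.injEq, Prod.mk.injEq, Fin.mk.injEq] at h
  exact slotNode_injective s (Prod.ext h.1 h.2)

/-- A removable choice of types for every cell of the row pairs and of the column pairs, and
arbitrary types for the free crossings. -/
abbrev Pattern (m n k : ℕ) :=
  (Fin m → Fin n → CellTypes) × (Fin m → Fin k → CellTypes) ×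
    (Fin m → Fin 2 → Bool) × (Fin m → Fin 2 → Bool)

theorem card_pattern (m n k : ℕ) :
    Nat.card (Pattern m n k) = 6 ^ (m * (n + k)) * 4 ^ (2 * m) := by
  simp only [Nat.card_prod, Nat.card_fun, card_cellTypes, Nat.card_fin,
    Nat.card_eq_fintype_card (α := Bool), Fintype.card_bool]
  ring

/-- The crossing type that a pattern prescribes at a labelled crossing. -/
def Pattern.value {m n k : ℕ} (p : Pattern m n k) : Slot m n k → Bool
  | .inl (r, c, u, v) => (p.1 r c).1 u v
  | .inr (.inl (c, r, u, v)) => (p.2.1 c r).1 u v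
  | .inr (.inr (.inl (r, u))) => p.2.2.1 r u
  | .inr (.inr (.inr (c, v))) => p.2.2.2 c v

theorem Pattern.value_injective {m n k : ℕ} :
    Function.Injective (Pattern.value : Pattern m n k → _) := by
  intro p p' h
  refine Prod.ext ?_ (Prod.ext ?_ (Prod.ext ?_ ?_))
  · ext r c u v
    exact congrFun h (.inl (r, c, u, v))
  · ext c r u v
    exact congrFun h (.inr (.inl (c, r, u, v)))
  · ext r u
    exact congrFun h (.inr (.inr (.inl (r, u))))
  · ext c v
    exact congrFun h (.inr (.inr (.inr (c, v))))

/-- The choice of crossing types outside the block given by a pattern. (Every outer crossing has a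
label, but this is not needed: an unlabelled one would get the value `false`.) -/
noncomputable def Pattern.outer {n k : ℕ} (hkn : k ≤ n) (s : Position n k)
    (p : Pattern (n - k) n k) : Outer hkn s → Bool :=
  Function.extend (slotOuter hkn s) p.value fun _ => false

theorem Pattern.outer_slotOuter {n k : ℕ} (hkn : k ≤ n) (s : Position n k)
    (p : Pattern (n - k) n k) (y : Slot (n - k) n k) :
    p.outer hkn s (slotOuter hkn s y) = p.value y :=
  (slotOuter_injective hkn s).extend_apply ..

theorem Pattern.embeds {n k : ℕ} (hkn : k ≤ n) (s : Position n k) (p : Pattern (n - k) n k) :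
    Embeds hkn s (p.outer hkn s) := by
  intro x hx
  have hval (y : Slot (n - k) n k) :
      typeAt x (slotNode s y).1 (slotNode s y).2 = p.value y := by
    rw [← p.outer_slotOuter hkn s y, ← hx]
    exact typeAt_val x (slotOuter hkn s y).1
  refine (reduces_block hkn s x ⟨fun r hr c hc => ?_, fun c hc r hr => ?_⟩).reducesTo
  · have h (u v : Fin 2) : _ = (p.1 ⟨r, hr⟩ ⟨c, hc⟩).1 u v := hval (.inl (⟨r, hr⟩, ⟨c, hc⟩, u, v))
    have hp := (p.1 ⟨r, hr⟩ ⟨c, hc⟩).2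
    rw [← h 0 0, ← h 0 1, ← h 1 0, ← h 1 1] at hp
    split_ifs with hi <;> simpa [slotNode, hi] using hp
  · have h (u v : Fin 2) : _ = (p.2.1 ⟨c, hc⟩ ⟨r, hr⟩).1 u v :=
      hval (.inr (.inl (⟨c, hc⟩, ⟨r, hr⟩, u, v)))
    have hp := (p.2.1 ⟨c, hc⟩ ⟨r, hr⟩).2
    rw [← h 0 0, ← h 0 1, ← h 1 0, ← h 1 1] at hp
    split_ifs with hi <;> simpa [slotNode, hi] using hp

theorem card_position_mul_card_pattern_le {n k : ℕ} (hkn : k ≤ n) :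
    (n - k + 1) ^ 2 * (6 ^ ((n - k) * (n + k)) * 4 ^ (2 * (n - k))) ≤
      Nat.card (Embedding hkn) := by
  have e : Nat.card (Position n k × Pattern (n - k) n k) =
      (n - k + 1) ^ 2 * (6 ^ ((n - k) * (n + k)) * 4 ^ (2 * (n - k))) := by
    rw [Nat.card_prod, card_pattern, Nat.card_prod, Nat.card_fin, sq]
  rw [← e]
  refine Nat.card_le_card_of_injective
    (fun z => ⟨⟨z.1, z.2.outer hkn z.1⟩, z.2.embeds hkn z.1⟩) ?_
  rintro ⟨s, p⟩ ⟨s', p'⟩ h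
  obtain ⟨rfl, h⟩ := Sigma.mk.inj (Subtype.mk.inj h)
  have h := eq_of_heq h
  congr 1
  refine Pattern.value_injective (funext fun y => ?_)
  rw [← p.outer_slotOuter hkn s, ← p'.outer_slotOuter hkn s, h]

/-- With `m = n - k` and `N = m (n + k)` the first term on the left is `4 ^ N * 4 ^ (2 * m)`, and
the second one is at most as large and present only if `m ≥ 2`. In this case `N ≥ 2` and
`6 ^ N > 2 * 4 ^ N`. -/
theorem bound_lt {n k : ℕ} (hkn : k < n) :
    2 ^ (2 * (n - k) * (n + k + 2)) +
          2 ^ ((n - k) * (n + 3 * k + 4)) *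
            (1 - (if n - k = 1 then 1 else 0) - (if n - k = 0 then 1 else 0)) <
      6 ^ ((n - k) * (n + k)) * 4 ^ (2 * (n - k)) := by
  obtain ⟨m, rfl⟩ := Nat.exists_eq_add_of_le hkn.le
  rw [Nat.add_sub_cancel_left]
  have hm : 0 < m := by omega
  set N := m * (k + m + k) with hN
  have e : 2 ^ (2 * m * (k + m + k + 2)) = 4 ^ N * 4 ^ (2 * m) := by
    rw [show 4 = 2 ^ 2 by rfl, ← pow_mul, ← pow_mul, ← pow_add, hN]
    ring_nf
  rw [e, if_neg hm.ne']
  by_cases h1 : m = 1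
  · have : 4 ^ N < 6 ^ N := Nat.pow_lt_pow_left (by norm_num) (by simp [hN, h1])
    simpa [h1] using this
  · have hN2 : 2 ≤ N := by nlinarith [show 2 ≤ m by omega]
    have hb : 2 ^ (m * (k + m + 3 * k + 4)) ≤ 4 ^ N * 4 ^ (2 * m) := by
      rw [← e]
      exact Nat.pow_le_pow_right (by norm_num) (by nlinarith)
    have h6 : 2 * 4 ^ N < 6 ^ N := by
      obtain ⟨M, hM⟩ := Nat.exists_eq_add_of_le hN2
      have : 4 ^ M ≤ 6 ^ M := Nat.pow_le_pow_left (by norm_num) M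
      rw [hM, pow_add, pow_add]
      have : 0 < 4 ^ M := by positivity
      omega
    rw [if_neg h1]
    have := Nat.mul_lt_mul_of_pos_right h6 (show 0 < 4 ^ (2 * m) by positivity)
    linarith

end LatticeKnot

theorem lemma1 (n k : ℕ) (hkn : k < n) :
    (n - k + 1) ^ 2 *
        (2 ^ (2 * (n - k) * (n + k + 2)) +
          2 ^ ((n - k) * (n + 3 * k + 4)) *
            (1 - (if n - k = 1 then 1 else 0) - (if n - k = 0 then 1 else 0))) <
      Nat.card (LatticeKnot.Embedding hkn.le) :=
  (Nat.mul_lt_mul_of_pos_left (LatticeKnot.bound_lt hkn) (by positivity)).trans_le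
    (LatticeKnot.card_position_mul_card_pattern_le hkn.le)
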